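/- Consider two hypotheses $H_0,H_1$ with prior probabilities $\pi_0,\pi_1>0$, $\pi_0+\pi_1=1$, and let $\mathbb P_j$ denote probability under $H_j$. Nodes $a_1,a_2,\ldots$ decide sequentially between them. Node $a_k$ has a private signal $X_k$ with values in a measurable space $(S,\mathcal S)$; under $H_j$ the $X_k$ are independent and identically distributed with law $\mathbb P^X_j$. The measures $\mathbb P^X_0$ and $\mathbb P^X_1$ are mutually absolutely continuous, and the likelihood ratio $L_X=d\mathbb P^X_1/d\mathbb P^X_0$ is unbounded: $\inf_{S'}L_X=0$ and $\sup_{S'}L_X=\infty$ for every $S'\in\mathcal S$ of probability $1$ under $(\mathbb P^X_0+\mathbb P^X_1)/2$. The decision $d_k\in\{0,1\}$ of $a_k$ is broadcast through a binary erasure channel with output $\hat d_k\in\{d_k,e\}$ and erasure probabilities $\mathbb P(\hat d_k=e\mid d_k=j)$, $j=0,1$, which are the same under both hypotheses; the channels of different nodes are independent of each other and of all private signals. Node $a_k$ observes $X_k$ and the vector $\hat D_{m_k}$ of the channel outputs of its $m_k$ immediate predecessors (of all its predecessors if $m_k\ge k-1$). A decision strategy is a sequence of thresholds $t_k>0$;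 under it, $a_k$ applies the likelihood ratio test $$d_k=1\ \text{ if } L_X(X_k)\,L^k_D(\hat D_{m_k})>t_k,\qquad d_k=0\ \text{ otherwise},\qquad L^k_D(v)=\frac{\mathbb P_1(\hat D_{m_k}=v)}{\mathbb P_0(\hat D_{m_k}=v)} .$$ Suppose that $m_k\to\infty$ as $k\to\infty$ and that there is $\epsilon>0$ such that $\mathbb P(\hat d_k=e\mid d_k=j)\le 1-\epsilon$ for $j=0,1$ and all $k$. Then there exists a decision strategy such that the error probability converges to $0$: $$\lim_{k\to\infty}\bigl(\pi_0\,\mathbb P_0(d_k=1)+\pi_1\,\mathbb P_1(d_k=0)\bigr)=0 .$$ -/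

import Mathlib

open MeasureTheory ProbabilityTheory Filter Topology
open scoped ENNReal

namespace ErasureLearning

/-- Hypotheses and decisions are encoded by `Bool` (`false` is `0`, `true` is `1`).
A broadcast message is `some d` if the decision `d` gets through, and `none` if it is erased. -/
abbrev Msg : Type := Option Bool

/-- The likelihood ratio `dμ₁/dμ₀` of a private signal, where `μ j` is the law of a
signal under the hypothesis `j`. -/
noncomputable def privateLR {S : Type*} [MeasurableSpace S] (μ : Bool → Measure S) (s : S) :
    ℝ≥0∞ :=
  (μ true).rnDeriv (μ false) s

/-- The likelihood ratios of the private signals are unbounded: on every set of full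
measure for `(μ₀ + μ₁) / 2` their infimum is `0` and their supremum is `∞`. -/
def UnboundedLR {S : Type*} [MeasurableSpace S] (μ : Bool → Measure S) : Prop :=
  ∀ S' : Set S, MeasurableSet S' → ((2 : ℝ≥0∞)⁻¹ • (μ false + μ true)) S' = 1 →
    (⨅ s ∈ S', privateLR μ s) = 0 ∧ (⨆ s ∈ S', privateLR μ s) = ∞

/-- The likelihood ratio `P₁(D = v) / P₀(D = v)` of the realization `v` of a discrete
observation `D`. -/
noncomputable def obsLR {Ω V : Type*} [MeasurableSpace Ω] (P : Bool → Measure Ω)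
    (D : Ω → V) (v : V) : ℝ≥0∞ :=
  P true {ω | D ω = v} / P false {ω | D ω = v}

/-- The output of a binary erasure channel with input `d`, where `erased j` tells whether
the channel erases the input `j`. -/
def channelOut (erased : Bool → Bool) (d : Bool) : Msg :=
  if erased d then none else some d

open scoped Classical in
/-- The decision of the node `k` (nodes are numbered from `0`), with private signals `X`,
channel behaviour `E` (`E k ω j` tells whether the broadcast of node `k` is erased when its
decision is `j`), memory sizes `m` and thresholds `t`. The node observes the messages of
its `m k` immediate predecessors `k - m k, …, k - 1` (of all its predecessors if
`m k ≥ k`), and applies the likelihood ratio test with threshold `t k` to its private signal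
and these messages. -/
noncomputable def decision {Ω S : Type*} [MeasurableSpace Ω] [MeasurableSpace S]
    (P : Bool → Measure Ω) (μ : Bool → Measure S) (X : ℕ → Ω → S)
    (E : ℕ → Ω → Bool → Bool) (m : ℕ → ℕ) (t : ℕ → ℝ) (k : ℕ) : Ω → Bool :=
  let D : Ω → (Set.Ico (k - m k) k → Msg) := fun ω i =>
    channelOut (E i ω) (decision P μ X E m t i ω)
  fun ω => decide (ENNReal.ofReal (t k) < privateLR μ (X k ω) * obsLR P D (D ω))
termination_by k
decreasing_by exact i.2.2

/-- The error probability `π₀ P₀(d = 1) + π₁ P₁(d = 0)` of a decision `d`, where `p j` is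
the prior probability of the hypothesis `j`. -/
noncomputable def errorProb {Ω : Type*} [MeasurableSpace Ω]
    (P : Bool → Measure Ω) (p : Bool → ℝ) (d : Ω → Bool) : ℝ :=
  p false * (P false).real {ω | d ω = true} + p true * (P true).real {ω | d ω = false}

end ErasureLearning

/-! Every node uses the Bayes threshold `p false / p true`. Its test then minimizes the error among
all randomized rules based on the same observations (`errorProb_le_risk_of_likelihoodRatioTest`), so
bounding its error only requires exhibiting one good rule.

The comparison rule reads the messages backwards in time and accepts a received decision `j` of node
`i` with probability `ε / (1 - q i j)`. Acceptance then has probability exactly `ε`, whatever was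
decided, so it does not bias the accepted decision (`integral_accept_mul`). The accepted bit is
combined with the node's own signal. Up to the probability `(1 - ε) ^ n` that none of `n` messages
is accepted, the risk is at most the worst risk obtained from a single undistorted decision and a
fresh signal (`risk_lastAcceptedRule_le`).

Unboundedness provides signals strong enough to overrule a bit, so an error that is not already
small drops by a fixed `γ > 0` (`exists_rule_risk_le`). Hence a positive limsup `c` of the errors is
impossible: errors eventually below `c + γ / 2` would eventually lie below some constant smaller
than `c` (`tendsto_zero_of_eventually_le_improve`). -/

namespace ErasureLearning

/-! ### Independence of σ-algebras -/

/-- If `m₁` and `m₂` are independent, and jointly independent of `m₃`, then `m₂` is independent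
of `m₁ ⊔ m₃`. -/
lemma indep_sup_of_indep_sup {Ω : Type*} {m₁ m₂ m₃ mΩ : MeasurableSpace Ω} {P : Measure Ω}
    [IsProbabilityMeasure P] (h₁ : m₁ ≤ mΩ) (h₂ : m₂ ≤ mΩ) (h₃ : m₃ ≤ mΩ)
    (h₁₂ : Indep m₁ m₂ P) (h : Indep (m₁ ⊔ m₂) m₃ P) : Indep m₂ (m₁ ⊔ m₃) P := by
  let π : Set (Set Ω) :=
    {s | ∃ A B, MeasurableSet[m₁] A ∧ MeasurableSet[m₃] B ∧ s = A ∩ B}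
  have hπ : IsPiSystem π := by
    rintro _ ⟨A, B, hA, hB, rfl⟩ _ ⟨A', B', hA', hB', rfl⟩ -
    exact ⟨A ∩ A', B ∩ B', hA.inter hA', hB.inter hB', Set.inter_inter_inter_comm ..⟩
  have hgen : m₁ ⊔ m₃ = MeasurableSpace.generateFrom π := by
    apply le_antisymm
    · refine sup_le (fun s hs => ?_) (fun s hs => ?_)
      · exact MeasurableSpace.measurableSet_generateFrom ⟨s, Set.univ, hs, .univ, by simp⟩
      · exact MeasurableSpace.measurableSet_generateFrom ⟨Set.univ, s, .univ, hs, by simp⟩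
    · refine MeasurableSpace.generateFrom_le ?_
      rintro _ ⟨A, B, hA, hB, rfl⟩
      exact MeasurableSet.inter ((le_sup_left : m₁ ≤ m₁ ⊔ m₃) _ hA)
        ((le_sup_right : m₃ ≤ m₁ ⊔ m₃) _ hB)
  refine IndepSets.indep h₂ (sup_le h₁ h₃) (@MeasurableSpace.isPiSystem_measurableSet Ω m₂) hπ
    (@MeasurableSpace.generateFrom_measurableSet Ω m₂).symm hgen ?_
  rw [IndepSets_iff]
  rintro C _ hC ⟨A, B, hA, hB, rfl⟩
  rw [Indep_iff] at h h₁₂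
  have hA' := (le_sup_left : m₁ ≤ m₁ ⊔ m₂) _ hA
  have hC' := (le_sup_right : m₂ ≤ m₁ ⊔ m₂) _ hC
  rw [show C ∩ (A ∩ B) = (A ∩ C) ∩ B by ext; simp; tauto, h _ _ (hA'.inter hC') hB,
    h _ _ hA' hB, h₁₂ _ _ hA hC]
  ring

lemma indep_comap_iSup_ne {Ω β : Type*} [MeasurableSpace Ω] [MeasurableSpace β]
    {P : Measure Ω} {Z : ℕ → Ω → β} (hZ : ∀ k, Measurable (Z k)) (hindep : iIndepFun Z P)
    (k : ℕ) :
    Indep (MeasurableSpace.comap (Z k) inferInstance)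
      (⨆ i ∈ ({k}ᶜ : Set ℕ), MeasurableSpace.comap (Z i) inferInstance) P := by
  have := indep_iSup_of_disjoint (fun i => (hZ i).comap_le) hindep
    (S := {k}) (T := {k}ᶜ) disjoint_compl_right
  simpa using this

/-! ### Bayes risk and optimality of the likelihood ratio test -/

/-- The risk `π₀ E₀[φ] + π₁ E₁[1 - φ]` of a randomized decision, where `φ` is the conditional
probability of deciding `1`. -/
noncomputable def risk {Ω : Type*} [MeasurableSpace Ω] (P : Bool → Measure Ω) (p : Bool → ℝ)
    (φ : Ω → ℝ) : ℝ :=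
  p true + (p false * ∫ ω, φ ω ∂P false - p true * ∫ ω, φ ω ∂P true)

lemma integral_bit {Ω : Type*} [MeasurableSpace Ω] (P : Measure Ω) {d : Ω → Bool}
    (hd : Measurable d) (j : Bool) :
    ∫ ω, (if d ω = j then (1 : ℝ) else 0) ∂P = P.real {ω | d ω = j} := by
  have h : MeasurableSet {ω | d ω = j} := hd (measurableSet_singleton j)
  rw [← integral_indicator_one h]
  exact integral_congr_ae (ae_of_all _ fun ω => by simp [Set.indicator_apply])

lemma errorProb_eq_risk {Ω : Type*} [MeasurableSpace Ω] (P : Bool → Measure Ω)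
    [∀ j, IsProbabilityMeasure (P j)] (p : Bool → ℝ) {d : Ω → Bool} (hd : Measurable d) :
    errorProb P p d = risk P p (fun ω => if d ω = true then 1 else 0) := by
  have h : MeasurableSet {ω | d ω = true} := hd (measurableSet_singleton true)
  have h' : {ω | d ω = false} = {ω | d ω = true}ᶜ := by ext; simp
  rw [errorProb, risk, integral_bit _ hd, integral_bit _ hd, h', probReal_compl_eq_one_sub h]
  ring

lemma integrable_of_mem_unitInterval {Ω : Type*} [MeasurableSpace Ω] {P : Measure Ω}
    [IsFiniteMeasure P] {f : Ω → ℝ} (hf : Measurable f) (h0 : ∀ ω, 0 ≤ f ω) (h1 : ∀ ω, f ω ≤ 1) :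
    Integrable f P :=
  Integrable.of_bound hf.aestronglyMeasurable 1
    (ae_of_all _ fun ω => by rw [Real.norm_eq_abs, abs_of_nonneg (h0 ω)]; exact h1 ω)

/-- Integration of a function of a signal and an independent discrete observation. -/
lemma integral_signal_obs {Ω S V : Type*} [MeasurableSpace Ω] [MeasurableSpace S]
    [MeasurableSpace V] [MeasurableSingletonClass V] [Fintype V] {P : Measure Ω}
    [IsProbabilityMeasure P] {X : Ω → S} {D : Ω → V} (hX : Measurable X) (hD : Measurable D)
    (hXD : IndepFun X D P) {φ : S → V → ℝ} (hφ : ∀ v, Measurable fun s => φ s v)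
    (h0 : ∀ s v, 0 ≤ φ s v) (h1 : ∀ s v, φ s v ≤ 1) :
    ∫ ω, φ (X ω) (D ω) ∂P = ∑ v, P.real {ω | D ω = v} * ∫ s, φ s v ∂(P.map X) := by
  classical
  have hind : ∀ v : V, Measurable fun w : V => if w = v then (1 : ℝ) else 0 := fun v =>
    Measurable.of_discrete
  have hsum : ∀ ω, φ (X ω) (D ω) = ∑ v, φ (X ω) v * (if D ω = v then (1 : ℝ) else 0) := by
    intro ω; simp
  simp_rw [hsum]
  rw [integral_finsetSum]
  · refine Finset.sum_congr rfl fun v _ => ?_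
    rw [hXD.integral_fun_comp_mul_comp (f := fun s => φ s v)
      (g := fun w => if w = v then (1 : ℝ) else 0) hX.aemeasurable hD.aemeasurable
      (hφ v).aestronglyMeasurable (hind v).aestronglyMeasurable,
      integral_map hX.aemeasurable (hφ v).aestronglyMeasurable, mul_comm]
    congr 1
    have h : MeasurableSet {ω | D ω = v} := hD (measurableSet_singleton v)
    rw [← integral_indicator_one h]
    exact integral_congr_ae (ae_of_all _ fun ω => by simp [Set.indicator_apply])
  · intro v _
    refine integrable_of_mem_unitInterval (((hφ v).comp hX).mul ((hind v).comp hD))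
      (fun ω => mul_nonneg (h0 _ _) (by split_ifs <;> simp)) (fun ω => ?_)
    have := h1 (X ω) v
    change φ (X ω) v * (if D ω = v then (1 : ℝ) else 0) ≤ 1
    split_ifs <;> simp [this]

/-- Changing measure from `μ true` to `μ false` puts both error terms under one integral, with a
weight independent of `φ`. Minimizing the risk becomes a pointwise question about the sign of that
weight. -/
lemma risk_signal_obs {Ω S V : Type*} [MeasurableSpace Ω] [MeasurableSpace S]
    [MeasurableSpace V] [MeasurableSingletonClass V] [Fintype V] {P : Bool → Measure Ω}
    [∀ j, IsProbabilityMeasure (P j)] {μ : Bool → Measure S} [∀ j, IsProbabilityMeasure (μ j)]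
    (hμ₁₀ : μ true ≪ μ false) (p : Bool → ℝ)
    {X : Ω → S} {D : Ω → V} (hX : Measurable X) (hD : Measurable D)
    (hlaw : ∀ h, (P h).map X = μ h)
    (hXD : ∀ h, IndepFun X D (P h)) {φ : S → V → ℝ} (hφ : ∀ v, Measurable fun s => φ s v)
    (h0 : ∀ s v, 0 ≤ φ s v) (h1 : ∀ s v, φ s v ≤ 1) :
    (∀ v, Integrable (fun s => φ s v * (p false * (P false).real {ω | D ω = v} -
        p true * (P true).real {ω | D ω = v} * (privateLR μ s).toReal)) (μ false)) ∧
    risk P p (fun ω => φ (X ω) (D ω)) = p true + ∑ v, ∫ s, φ s v *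
      (p false * (P false).real {ω | D ω = v} -
        p true * (P true).real {ω | D ω = v} * (privateLR μ s).toReal) ∂μ false := by
  have hi : ∀ v, Integrable (fun s => φ s v) (μ false) := fun v =>
    integrable_of_mem_unitInterval (hφ v) (fun s => h0 s v) (fun s => h1 s v)
  have hi' : ∀ v, Integrable (fun s => (privateLR μ s).toReal * φ s v) (μ false) := fun v => by
    have := (integrable_rnDeriv_smul_iff hμ₁₀ (f := fun s => φ s v)).2
      (integrable_of_mem_unitInterval (hφ v) (fun s => h0 s v) (fun s => h1 s v))
    simpa [privateLR] using this
  have hre : ∀ v, (fun s => φ s v * (p false * (P false).real {ω | D ω = v} -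
        p true * (P true).real {ω | D ω = v} * (privateLR μ s).toReal)) = fun s =>
      p false * (P false).real {ω | D ω = v} * φ s v -
        p true * (P true).real {ω | D ω = v} * ((privateLR μ s).toReal * φ s v) := fun v => by
    funext s; ring
  refine ⟨fun v => ?_, ?_⟩
  · rw [hre]
    exact ((hi v).const_mul _).sub ((hi' v).const_mul _)
  · rw [risk, integral_signal_obs hX hD (hXD false) hφ h0 h1,
      integral_signal_obs hX hD (hXD true) hφ h0 h1, hlaw, hlaw, Finset.mul_sum, Finset.mul_sum,
      ← Finset.sum_sub_distrib]
    congr 1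
    refine Finset.sum_congr rfl fun v _ => ?_
    rw [hre, integral_sub ((hi v).const_mul _) ((hi' v).const_mul _), integral_const_mul,
      integral_const_mul]
    have : ∫ s, (privateLR μ s).toReal * φ s v ∂μ false = ∫ s, φ s v ∂μ true := by
      rw [← integral_rnDeriv_smul hμ₁₀]; rfl
    rw [this]
    ring

/-- The likelihood ratio test with threshold `π₀ / π₁` minimizes the risk among all randomized
decisions that are based on the same observations. -/
theorem errorProb_le_risk_of_likelihoodRatioTest {Ω S V : Type*} [MeasurableSpace Ω]
    [MeasurableSpace S] [MeasurableSpace V] [MeasurableSingletonClass V] [Fintype V]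
    {P : Bool → Measure Ω} [∀ j, IsProbabilityMeasure (P j)] {μ : Bool → Measure S}
    [∀ j, IsProbabilityMeasure (μ j)] (hμ₁₀ : μ true ≪ μ false) {p : Bool → ℝ}
    (hp : ∀ j, 0 < p j) {X : Ω → S} {D : Ω → V} (hX : Measurable X) (hD : Measurable D)
    (hlaw : ∀ h, (P h).map X = μ h) (hXD : ∀ h, IndepFun X D (P h))
    {φ : S → V → ℝ} (hφ : ∀ v, Measurable fun s => φ s v)
    (h0 : ∀ s v, 0 ≤ φ s v) (h1 : ∀ s v, φ s v ≤ 1) {d : Ω → Bool} (hdm : Measurable d)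
    (hd : ∀ ω, d ω = true ↔
      ENNReal.ofReal (p false / p true) < privateLR μ (X ω) * obsLR P D (D ω)) :
    errorProb P p d ≤ risk P p (fun ω => φ (X ω) (D ω)) := by
  classical
  let ψ : S → V → ℝ := fun s v =>
    if ENNReal.ofReal (p false / p true) < privateLR μ s * obsLR P D v then 1 else 0
  have hψd : (fun ω => if d ω = true then (1 : ℝ) else 0) = fun ω => ψ (X ω) (D ω) := by
    funext ω; simp only [ψ, hd]
  have hψ : ∀ v, Measurable fun s => ψ s v := fun v =>
    Measurable.ite (measurableSet_lt measurable_const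
      ((Measure.measurable_rnDeriv _ _).mul_const _)) measurable_const measurable_const
  obtain ⟨hiφ, hφr⟩ := risk_signal_obs hμ₁₀ p hX hD hlaw hXD hφ h0 h1
  obtain ⟨hiψ, hψr⟩ := risk_signal_obs hμ₁₀ p hX hD hlaw hXD hψ
    (fun s v => by simp only [ψ]; split_ifs <;> simp)
    (fun s v => by simp only [ψ]; split_ifs <;> simp)
  rw [errorProb_eq_risk P p hdm, hψd, hφr, hψr]
  refine add_le_add le_rfl (Finset.sum_le_sum fun v _ => ?_)
  refine integral_mono_ae (hiψ v) (hiφ v) ?_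
  filter_upwards [Measure.rnDeriv_lt_top (μ true) (μ false)] with s hs
  change privateLR μ s < ∞ at hs
  obtain ⟨x, hx⟩ : ∃ x, x = privateLR μ s := ⟨_, rfl⟩
  have hp0 := hp false
  have hp1 := hp true
  have hφ0 := h0 s v
  have hφ1 := h1 s v
  simp only [ψ, obsLR, measureReal_def, ← hx] at hs ⊢
  have ha : P false {ω | D ω = v} ≠ ∞ := measure_ne_top _ _
  have hb : P true {ω | D ω = v} ≠ ∞ := measure_ne_top _ _
  generalize P false {ω | D ω = v} = a at *
  generalize P true {ω | D ω = v} = b at *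
  lift a to NNReal using ha
  lift b to NNReal using hb
  lift x to NNReal using hs.ne
  simp only [ENNReal.coe_toReal]
  -- For `a ≠ 0` the test decides `1` exactly where the weight is negative. For `a = 0` the weight
  -- is never positive; the conventions `0 / 0 = 0` and `0 * ∞ = 0` only matter where it vanishes,
  -- and elsewhere the ratio is `∞` and the test decides `1`.
  rcases eq_or_ne a 0 with rfl | ha0
  · rcases eq_or_ne b 0 with rfl | hb0
    · simp
    · rcases eq_or_ne x 0 with rfl | hx0
      · simp
      · rw [if_pos]
        · simp only [NNReal.coe_zero, mul_zero, zero_sub]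
          have : 0 ≤ p true * b * x := by positivity
          nlinarith
        · rw [ENNReal.coe_zero, ENNReal.div_zero (by simpa using hb0),
            ENNReal.mul_top (by simpa using hx0)]
          exact ENNReal.ofReal_lt_top
  · have hapos : (0 : ℝ) < a := by positivity
    have hiff : ENNReal.ofReal (p false / p true) < (x : ℝ≥0∞) * ((b : ℝ≥0∞) / a) ↔
        p false * a - p true * b * x < 0 := by
      rw [← ENNReal.coe_div ha0, ← ENNReal.coe_mul, ENNReal.ofReal_lt_coe_iff (by positivity)]
      push_cast
      rw [div_lt_iff₀ hp1, mul_div_assoc', div_mul_eq_mul_div, lt_div_iff₀ hapos, sub_neg]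
      ring_nf
    simp only [hiff]
    split_ifs with h <;> nlinarith

/-! ### Improving a bit with one strong private signal -/

lemma half_add_eq_one {S : Type*} [MeasurableSpace S] {μ : Bool → Measure S}
    [∀ j, IsProbabilityMeasure (μ j)] {A : Set S} (hA : MeasurableSet A)
    (h : ∀ j, μ j Aᶜ = 0) : ((2 : ℝ≥0∞)⁻¹ • (μ false + μ true)) A = 1 := by
  have h' : ∀ j, μ j A = 1 := fun j => (prob_compl_eq_zero_iff hA).1 (h j)
  simp only [Measure.smul_apply, Measure.add_apply, h', smul_eq_mul]
  rw [one_add_one_eq_two]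
  exact ENNReal.inv_mul_cancel (by simp) (by simp)

lemma measurable_privateLR {S : Type*} [MeasurableSpace S] (μ : Bool → Measure S) :
    Measurable (privateLR μ) :=
  Measure.measurable_rnDeriv _ _

/-- Otherwise absolute continuity makes the set null under both laws, and its complement is a set of
full measure on which the ratio is bounded by `r`. -/
lemma UnboundedLR.measureReal_gt_pos {S : Type*} [MeasurableSpace S] {μ : Bool → Measure S}
    [∀ j, IsProbabilityMeasure (μ j)] (hμ : UnboundedLR μ) (hμ₀₁ : μ false ≪ μ true)
    {r : ℝ≥0∞} (hr : r ≠ ∞) : 0 < (μ true).real {s | r < privateLR μ s} := by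
  have hA : MeasurableSet {s | privateLR μ s ≤ r} :=
    measurableSet_le (measurable_privateLR μ) measurable_const
  have hc : {s | privateLR μ s ≤ r}ᶜ = {s | r < privateLR μ s} := by ext; simp
  rw [measureReal_def, ENNReal.toReal_pos_iff]
  refine ⟨pos_iff_ne_zero.2 fun h => hr ?_, measure_lt_top _ _⟩
  have := (hμ _ hA (half_add_eq_one hA (by
    rw [hc]; exact Bool.forall_bool.2 ⟨hμ₀₁ h, h⟩))).2
  rw [← top_le_iff, ← this]
  exact iSup₂_le fun s hs => hs

lemma UnboundedLR.measureReal_lt_pos {S : Type*} [MeasurableSpace S] {μ : Bool → Measure S}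
    [∀ j, IsProbabilityMeasure (μ j)] (hμ : UnboundedLR μ) (hμ₁₀ : μ true ≪ μ false)
    {r : ℝ≥0∞} (hr : r ≠ 0) : 0 < (μ false).real {s | privateLR μ s < r} := by
  have hA : MeasurableSet {s | r ≤ privateLR μ s} :=
    measurableSet_le measurable_const (measurable_privateLR μ)
  have hc : {s | r ≤ privateLR μ s}ᶜ = {s | privateLR μ s < r} := by ext; simp
  rw [measureReal_def, ENNReal.toReal_pos_iff]
  refine ⟨pos_iff_ne_zero.2 fun h => hr ?_, measure_lt_top _ _⟩
  have := (hμ _ hA (half_add_eq_one hA (by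
    rw [hc]; exact Bool.forall_bool.2 ⟨h, hμ₁₀ h⟩))).1
  rw [← nonpos_iff_eq_zero, ← this]
  exact le_iInf₂ fun s hs => hs

lemma mul_measureReal_gt_le {S : Type*} [MeasurableSpace S] {μ : Bool → Measure S}
    [∀ j, IsProbabilityMeasure (μ j)] (hμ₁₀ : μ true ≪ μ false) {r : ℝ} (hr : 0 ≤ r) :
    r * (μ false).real {s | ENNReal.ofReal r < privateLR μ s} ≤
      (μ true).real {s | ENNReal.ofReal r < privateLR μ s} := by
  have hA : MeasurableSet {s | ENNReal.ofReal r < privateLR μ s} :=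
    measurableSet_lt measurable_const (measurable_privateLR μ)
  have h : ENNReal.ofReal r * μ false {s | ENNReal.ofReal r < privateLR μ s} ≤
      μ true {s | ENNReal.ofReal r < privateLR μ s} := by
    rw [← Measure.setLIntegral_rnDeriv' hμ₁₀ hA, ← setLIntegral_const]
    exact setLIntegral_mono' hA fun s hs => hs.le
  have := ENNReal.toReal_mono (measure_ne_top _ _) h
  rwa [ENNReal.toReal_mul, ENNReal.toReal_ofReal hr] at this

lemma measureReal_lt_le_mul {S : Type*} [MeasurableSpace S] {μ : Bool → Measure S}
    [∀ j, IsProbabilityMeasure (μ j)] (hμ₁₀ : μ true ≪ μ false) {r : ℝ} (hr : 0 ≤ r) :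
    (μ true).real {s | privateLR μ s < ENNReal.ofReal r} ≤
      r * (μ false).real {s | privateLR μ s < ENNReal.ofReal r} := by
  have hA : MeasurableSet {s | privateLR μ s < ENNReal.ofReal r} :=
    measurableSet_lt (measurable_privateLR μ) measurable_const
  have h : μ true {s | privateLR μ s < ENNReal.ofReal r} ≤
      ENNReal.ofReal r * μ false {s | privateLR μ s < ENNReal.ofReal r} := by
    rw [← Measure.setLIntegral_rnDeriv' hμ₁₀ hA, ← setLIntegral_const]
    exact setLIntegral_mono' hA fun s hs => hs.le
  have := ENNReal.toReal_mono (ENNReal.mul_ne_top (by simp) (measure_ne_top _ _)) h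
  rwa [ENNReal.toReal_mul, ENNReal.toReal_ofReal hr] at this

lemma risk_bit_signal {Ω S : Type*} [MeasurableSpace Ω] [MeasurableSpace S]
    {P : Bool → Measure Ω} [∀ j, IsProbabilityMeasure (P j)] {μ : Bool → Measure S}
    (p : Bool → ℝ) {X : Ω → S} {d : Ω → Bool} (hX : Measurable X) (hd : Measurable d)
    (hlaw : ∀ h, (P h).map X = μ h) (hXd : ∀ h, IndepFun X d (P h))
    {f : Bool → S → ℝ} (hf : ∀ j, Measurable (f j)) (h0 : ∀ j s, 0 ≤ f j s)
    (h1 : ∀ j s, f j s ≤ 1) :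
    risk P p (fun ω => f (d ω) (X ω)) = p true +
      (p false * ((P false).real {ω | d ω = true} * ∫ s, f true s ∂μ false +
          (1 - (P false).real {ω | d ω = true}) * ∫ s, f false s ∂μ false) -
        p true * ((1 - (P true).real {ω | d ω = false}) * ∫ s, f true s ∂μ true +
          (P true).real {ω | d ω = false} * ∫ s, f false s ∂μ true)) := by
  have hm : MeasurableSet {ω | d ω = false} := hd (measurableSet_singleton false)
  have hc : {ω | d ω = true} = {ω | d ω = false}ᶜ := by ext; simp
  rw [risk, integral_signal_obs (φ := fun s j => f j s) hX hd (hXd false) hf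
      (fun s j => h0 j s) (fun s j => h1 j s),
    integral_signal_obs (φ := fun s j => f j s) hX hd (hXd true) hf
      (fun s j => h0 j s) (fun s j => h1 j s), hlaw, hlaw]
  simp only [Fintype.sum_bool, hc, probReal_compl_eq_one_sub hm]
  ring

/-- A bit whose error probability is not small can be improved, by a fixed amount, with the help
of one further private signal. -/
theorem exists_rule_risk_le {Ω S : Type*} [MeasurableSpace Ω] [MeasurableSpace S]
    {P : Bool → Measure Ω} [∀ j, IsProbabilityMeasure (P j)] {μ : Bool → Measure S}
    [∀ j, IsProbabilityMeasure (μ j)] (hμ₀₁ : μ false ≪ μ true) (hμ₁₀ : μ true ≪ μ false)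
    (hμ : UnboundedLR μ) {p : Bool → ℝ} (hp : ∀ j, 0 < p j) (hp_sum : p false + p true = 1)
    {c : ℝ} (hc : 0 < c) :
    ∃ γ : ℝ, 0 < γ ∧ ∀ (X : Ω → S) (d : Ω → Bool), Measurable X → Measurable d →
      (∀ h, (P h).map X = μ h) → (∀ h, IndepFun X d (P h)) →
      ∃ f : Bool → S → ℝ, (∀ j, Measurable (f j)) ∧ (∀ j s, 0 ≤ f j s) ∧ (∀ j s, f j s ≤ 1) ∧
        risk P p (fun ω => f (d ω) (X ω)) ≤ max (c / 2) (errorProb P p d - γ) := by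
  classical
  -- Signals in `A` (in `B`) are strong evidence for `true` (for `false`): the misleading hypothesis
  -- gives the set at most `c / 8` times the mass the other one does.
  set A : Set S := {s | ENNReal.ofReal (8 / c) < privateLR μ s} with hAdef
  set B : Set S := {s | privateLR μ s < ENNReal.ofReal (c / 8)}
  have hA : MeasurableSet A := measurableSet_lt measurable_const (measurable_privateLR μ)
  have hB : MeasurableSet B := measurableSet_lt (measurable_privateLR μ) measurable_const
  have hApos : 0 < (μ true).real A := hμ.measureReal_gt_pos hμ₀₁ ENNReal.ofReal_ne_top
  have hBpos : 0 < (μ false).real B :=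
    hμ.measureReal_lt_pos hμ₁₀ (ENNReal.ofReal_pos.2 (by positivity)).ne'
  have hAle : (μ false).real A ≤ c / 8 * (μ true).real A := by
    have := mul_measureReal_gt_le hμ₁₀ (r := 8 / c) (by positivity)
    rw [← hAdef, div_mul_eq_mul_div, div_le_iff₀ hc] at this
    linarith
  have hBle : (μ true).real B ≤ c / 8 * (μ false).real B :=
    measureReal_lt_le_mul hμ₁₀ (by positivity)
  have hp0 := hp false
  have hp1 := hp true
  -- The gain depends only on `c` and `μ`, hence is uniform over all bits and signals.
  refine ⟨c / 8 * min ((μ true).real A) ((μ false).real B), by positivity,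
    fun X d hX hd hlaw hXd => ?_⟩
  have hγA := mul_le_mul_of_nonneg_left
    (min_le_left ((μ true).real A) ((μ false).real B)) (by positivity : 0 ≤ c / 8)
  have hγB := mul_le_mul_of_nonneg_left
    (min_le_right ((μ true).real A) ((μ false).real B)) (by positivity : 0 ≤ c / 8)
  set γ := c / 8 * min ((μ true).real A) ((μ false).real B)
  have hα0 : 0 ≤ (P false).real {ω | d ω = true} := measureReal_nonneg
  have hα1 : (P false).real {ω | d ω = true} ≤ 1 := measureReal_le_one
  have hβ0 : 0 ≤ (P true).real {ω | d ω = false} := measureReal_nonneg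
  have hβ1 : (P true).real {ω | d ω = false} ≤ 1 := measureReal_le_one
  by_cases hsmall : errorProb P p d ≤ c / 2
  · refine ⟨fun j _ => if j = true then 1 else 0, fun j => measurable_const,
      Bool.forall_bool.2 ⟨by simp, by simp⟩, Bool.forall_bool.2 ⟨by simp, by simp⟩, ?_⟩
    rw [← errorProb_eq_risk P p hd]
    exact le_max_of_le_left hsmall
  · have hind : ∀ (j : Bool) (C : Set S), MeasurableSet C →
        ∫ s, C.indicator (fun _ => (1 : ℝ)) s ∂μ j = (μ j).real C := fun j C hC =>
      integral_indicator_one hC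
    have hnn : ∀ (C : Set S) s, 0 ≤ C.indicator (fun _ => (1 : ℝ)) s := fun C s =>
      Set.indicator_nonneg (fun _ _ => zero_le_one) s
    have hle : ∀ (C : Set S) s, C.indicator (fun _ => (1 : ℝ)) s ≤ 1 := fun C s =>
      Set.indicator_le_self' (fun _ _ => zero_le_one) s
    rw [errorProb] at hsmall ⊢
    -- The total error exceeds `c / 2`, so one of its two terms is at least `c / 4`. If it is the
    -- missed detection, a bit `false` is overruled on `A`: this gains at least `c / 4 * μ₁(A)` and
    -- costs at most `μ₀(A) ≤ c / 8 * μ₁(A)`.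
    by_cases hβ : c / 4 ≤ p true * (P true).real {ω | d ω = false}
    · have hfm : ∀ j, Measurable
          ((fun j s => if j = true then 1 else A.indicator (fun _ => 1) s : Bool → S → ℝ) j) :=
        Bool.forall_bool.2 ⟨by simpa using measurable_const.indicator hA, by simp⟩
      refine ⟨_, hfm, Bool.forall_bool.2 ⟨by simpa using hnn A, by simp⟩,
        Bool.forall_bool.2 ⟨by simpa using hle A, by simp⟩, le_max_of_le_right ?_⟩
      rw [risk_bit_signal p hX hd hlaw hXd hfm
        (Bool.forall_bool.2 ⟨by simpa using hnn A, by simp⟩)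
        (Bool.forall_bool.2 ⟨by simpa using hle A, by simp⟩)]
      simp only [if_true, Bool.false_eq_true, if_false, hind _ A hA, integral_const, probReal_univ,
        smul_eq_mul, mul_one]
      generalize (P false).real {ω | d ω = true} = α at *
      generalize (P true).real {ω | d ω = false} = β at *
      have h1 : p false * (1 - α) * (μ false).real A ≤ 1 * (μ false).real A := by
        gcongr
        nlinarith
      have h2 := mul_le_mul_of_nonneg_right hβ hApos.le
      linarith
    -- Symmetrically, a bit `true` is overruled on `B`.
    · have hα : c / 4 ≤ p false * (P false).real {ω | d ω = true} := by linarith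
      have hfm : ∀ j, Measurable
          ((fun j s => if j = true then Bᶜ.indicator (fun _ => 1) s else 0 : Bool → S → ℝ) j) :=
        Bool.forall_bool.2 ⟨by simp, by simpa using measurable_const.indicator hB.compl⟩
      refine ⟨_, hfm, Bool.forall_bool.2 ⟨by simp, by simpa using hnn Bᶜ⟩,
        Bool.forall_bool.2 ⟨by simp, by simpa using hle Bᶜ⟩, le_max_of_le_right ?_⟩
      rw [risk_bit_signal p hX hd hlaw hXd hfm
        (Bool.forall_bool.2 ⟨by simp, by simpa using hnn Bᶜ⟩)
        (Bool.forall_bool.2 ⟨by simp, by simpa using hle Bᶜ⟩)]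
      simp only [if_true, Bool.false_eq_true, if_false, hind _ _ hB.compl, integral_zero,
        probReal_compl_eq_one_sub hB]
      generalize (P false).real {ω | d ω = true} = α at *
      generalize (P true).real {ω | d ω = false} = β at *
      have h1 : p true * (1 - β) * (μ true).real B ≤ 1 * (μ true).real B := by
        gcongr
        nlinarith
      have h2 := mul_le_mul_of_nonneg_right hα hBpos.le
      linarith

/-! ### Measurability of decisions -/

lemma decision_eq_true_iff {Ω S : Type*} [MeasurableSpace Ω] [MeasurableSpace S]
    (P : Bool → Measure Ω) (μ : Bool → Measure S) (X : ℕ → Ω → S)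
    (E : ℕ → Ω → Bool → Bool) (m : ℕ → ℕ) (t : ℕ → ℝ) (k : ℕ) (ω : Ω) :
    decision P μ X E m t k ω = true ↔ ENNReal.ofReal (t k) < privateLR μ (X k ω) *
      obsLR P (fun ω (i : Set.Ico (k - m k) k) =>
        channelOut (E i ω) (decision P μ X E m t i ω))
      (fun i : Set.Ico (k - m k) k => channelOut (E i ω) (decision P μ X E m t i ω)) := by
  rw [decision, decide_eq_true_iff]

lemma measurable_channelOut_comp {Ω β : Type*} {𝓖 : MeasurableSpace Ω} [MeasurableSpace β]
    {e : Ω → Bool → Bool} {d : Ω → Bool} (he : Measurable e) (hd : Measurable d) (g : Msg → β) :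
    Measurable fun ω => g (channelOut (e ω) (d ω)) :=
  (Measurable.of_discrete (f := fun x : (Bool → Bool) × Bool => g (channelOut x.1 x.2))).comp
    (he.prodMk hd)

lemma measurable_of_eq_true_iff_lt {Ω S V : Type*} {𝓖 : MeasurableSpace Ω} [MeasurableSpace S]
    [MeasurableSpace V] [DiscreteMeasurableSpace V] {X : Ω → S} {D : Ω → V} {L : S → ℝ≥0∞}
    {g : V → ℝ≥0∞} {c : ℝ≥0∞} {d : Ω → Bool} (hX : Measurable X) (hD : Measurable D)
    (hL : Measurable L) (hd : ∀ ω, d ω = true ↔ c < L (X ω) * g (D ω)) : Measurable d := by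
  refine measurable_to_bool ?_
  have : d ⁻¹' {true} = {ω | c < L (X ω) * g (D ω)} := by
    ext ω
    exact hd ω
  rw [this]
  exact measurableSet_lt measurable_const
    ((hL.comp hX).mul ((Measurable.of_discrete (f := g)).comp hD))

/-- A decision is measurable with respect to every σ-algebra that makes the earlier channels and
the private signals up to the deciding node measurable. -/
lemma measurable_decision {Ω S : Type*} {𝓖 mΩ : MeasurableSpace Ω} [MeasurableSpace S]
    (P : Bool → Measure Ω) (μ : Bool → Measure S) {X : ℕ → Ω → S}
    {E : ℕ → Ω → Bool → Bool} (m : ℕ → ℕ) (t : ℕ → ℝ) (k : ℕ)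
    (hX : ∀ i ≤ k, Measurable[𝓖] (X i)) (hE : ∀ i < k, Measurable[𝓖] (E i)) :
    Measurable[𝓖] (decision P μ X E m t k) := by
  induction k using Nat.strong_induction_on with
  | _ k ih =>
    let _ : MeasurableSpace Msg := ⊤
    have hD : Measurable[𝓖] fun ω (i : Set.Ico (k - m k) k) =>
        channelOut (E i ω) (decision P μ X E m t i ω) :=
      @measurable_pi_lambda _ _ _ 𝓖 _ _ fun i => measurable_channelOut_comp (hE i i.2.2)
        (ih i i.2.2 (fun j hj => hX j (hj.trans i.2.2.le)) fun j hj => hE j (hj.trans i.2.2)) id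
    exact measurable_of_eq_true_iff_lt (hX k le_rfl) hD (measurable_privateLR μ)
      (decision_eq_true_iff P μ X E m t k)

/-! ### The rule based on the last accepted decision -/

/-- Randomized decision based on the messages of the nodes `r, …, r + n - 1` and on a private
signal: the messages are read from the latest to the earliest, a received decision `j` of the
node `i` is accepted with probability `a i j`, and the rule `f i` is applied to the first accepted
decision. The value is the probability of deciding `1`. -/
noncomputable def lastAcceptedRule {S : Type*} (a : ℕ → Bool → ℝ) (f : ℕ → Bool → S → ℝ)
    (r : ℕ) : ℕ → (ℕ → Msg) → S → ℝ
  | 0, _, _ => 0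
  | n + 1, v, s => (v (r + n)).elim (lastAcceptedRule a f r n v s) fun j =>
      a (r + n) j * f (r + n) j s + (1 - a (r + n) j) * lastAcceptedRule a f r n v s

section Rule

variable {S : Type*} {a : ℕ → Bool → ℝ} {f : ℕ → Bool → S → ℝ}

lemma lastAcceptedRule_congr (r n : ℕ) {v w : ℕ → Msg} (s : S)
    (h : ∀ i, r ≤ i → i < r + n → v i = w i) :
    lastAcceptedRule a f r n v s = lastAcceptedRule a f r n w s := by
  induction n with
  | zero => rfl
  | succ n ih =>
    rw [lastAcceptedRule, lastAcceptedRule, h (r + n) (by omega) (by omega),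
      ih fun i h1 h2 => h i h1 (by omega)]

lemma lastAcceptedRule_mem_Icc (ha0 : ∀ i j, 0 ≤ a i j) (ha1 : ∀ i j, a i j ≤ 1)
    (hf0 : ∀ i j s, 0 ≤ f i j s) (hf1 : ∀ i j s, f i j s ≤ 1) (r n : ℕ) (v : ℕ → Msg) (s : S) :
    0 ≤ lastAcceptedRule a f r n v s ∧ lastAcceptedRule a f r n v s ≤ 1 := by
  induction n with
  | zero => simp [lastAcceptedRule]
  | succ n ih =>
    rw [lastAcceptedRule]
    rcases v (r + n) with _ | j
    · exact ih
    · simp only [Option.elim]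
      have h1 := ha0 (r + n) j
      have h2 := ha1 (r + n) j
      have h3 := hf0 (r + n) j s
      have h4 := hf1 (r + n) j s
      obtain ⟨h5, h6⟩ := ih
      constructor <;> nlinarith

lemma measurable_lastAcceptedRule [MeasurableSpace S] (hf : ∀ i j, Measurable (f i j))
    (r n : ℕ) (v : ℕ → Msg) : Measurable (lastAcceptedRule a f r n v) := by
  induction n with
  | zero => exact measurable_const
  | succ n ih =>
    change Measurable fun s => (v (r + n)).elim (lastAcceptedRule a f r n v s) fun j =>
      a (r + n) j * f (r + n) j s + (1 - a (r + n) j) * lastAcceptedRule a f r n v s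
    rcases v (r + n) with _ | j
    · exact ih
    · exact ((hf _ j).const_mul _).add (ih.const_mul _)

/-- An erasure amounts to acceptance weight `0`. In this form the channel enters only through the
weight, ready for `integral_accept_mul`. -/
lemma lastAcceptedRule_succ (r n : ℕ) (v : ℕ → Msg) (s : S) {e : Bool → Bool} {d : Bool}
    (hv : v (r + n) = channelOut e d) :
    lastAcceptedRule a f r (n + 1) v s = (if e d = true then 0 else a (r + n) d) *
      (f (r + n) d s - lastAcceptedRule a f r n v s) + lastAcceptedRule a f r n v s := by
  rw [lastAcceptedRule, hv, channelOut]
  split_ifs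
  · simp
  · simp only [Option.elim]; ring

lemma measurable_bit_rule {Ω : Type*} [MeasurableSpace S] {𝓖 : MeasurableSpace Ω}
    {g : Bool → S → ℝ} (hg : ∀ j, Measurable (g j)) {d : Ω → Bool} {X : Ω → S}
    (hd : Measurable d) (hX : Measurable X) : Measurable fun ω => g (d ω) (X ω) :=
  (measurable_from_prod_countable_right (f := fun x : Bool × S => g x.1 x.2) hg).comp
    (hd.prodMk hX)

lemma measurable_lastAcceptedRule_comp {Ω : Type*} [MeasurableSpace S] {𝓖 : MeasurableSpace Ω}
    (hf : ∀ i j, Measurable (f i j)) {X : Ω → S} {E : ℕ → Ω → Bool → Bool} {d : ℕ → Ω → Bool}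
    (r n : ℕ) (hX : Measurable X) (hE : ∀ i < r + n, Measurable (E i))
    (hd : ∀ i < r + n, Measurable (d i)) :
    Measurable fun ω =>
      lastAcceptedRule a f r n (fun i => channelOut (E i ω) (d i ω)) (X ω) := by
  induction n with
  | zero => exact measurable_const
  | succ n ih =>
    simp only [fun ω => lastAcceptedRule_succ (a := a) (f := f) r n
      (fun i => channelOut (E i ω) (d i ω)) (X ω) rfl]
    have ih := ih (fun i hi => hE i (by omega)) (fun i hi => hd i (by omega))
    have h1 : Measurable fun ω => if E (r + n) ω (d (r + n) ω) = true then (0 : ℝ)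
        else a (r + n) (d (r + n) ω) :=
      (Measurable.of_discrete (f := fun x : (Bool → Bool) × Bool =>
        if x.1 x.2 = true then (0 : ℝ) else a (r + n) x.2)).comp
        ((hE _ (by omega)).prodMk (hd _ (by omega)))
    exact (h1.mul ((measurable_bit_rule (hf _) (hd _ (by omega)) hX).sub ih)).add ih

end Rule

/-- Accepting the decision `j` with probability `ε / (1 - q j)` turns the erasure channel into one
whose acceptances occur with probability `ε`, independently of everything else. -/
lemma integral_accept_mul {Ω : Type*} {𝓗 mΩ : MeasurableSpace Ω} {P : Measure Ω}
    [IsProbabilityMeasure P] (h𝓗 : 𝓗 ≤ mΩ) {e : Ω → Bool → Bool} (he : Measurable e)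
    (hindep : Indep (MeasurableSpace.comap e inferInstance) 𝓗 P) {d : Ω → Bool} {G : Ω → ℝ}
    (hd : Measurable[𝓗] d) (hG : Measurable[𝓗] G) (hGi : Integrable G P) {q : Bool → ℝ}
    (hq : ∀ j, P.real {ω | e ω j = true} = q j) (hq1 : ∀ j, q j < 1) (ε : ℝ) :
    ∫ ω, (if e ω (d ω) = true then 0 else ε / (1 - q (d ω))) * G ω ∂P = ε * ∫ ω, G ω ∂P := by
  -- Splitting by the value `j` of `d` makes each term a product of a function of `e` and an
  -- `𝓗`-measurable function; the survival probability `1 - q j` then cancels.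
  have hGj : ∀ j, Measurable[𝓗] fun ω => if d ω = j then G ω else 0 := fun j =>
    Measurable.ite (hd (measurableSet_singleton j)) hG measurable_const
  have hej : ∀ j, Measurable fun x : Bool → Bool => if x j = true then (0 : ℝ) else 1 := fun j =>
    Measurable.of_discrete
  have hGji : ∀ j, Integrable (fun ω => if d ω = j then G ω else 0) P := fun j =>
    hGi.mono ((hGj j).mono h𝓗 le_rfl).aestronglyMeasurable
      (ae_of_all _ fun ω => by split_ifs <;> simp)
  have hind : ∀ j, IndepFun (fun ω => if e ω j = true then (0 : ℝ) else 1)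
      (fun ω => if d ω = j then G ω else 0) P := fun j => by
    have : IndepFun e (fun ω => if d ω = j then G ω else 0) P :=
      indep_of_indep_of_le_right hindep (hGj j).comap_le
    exact this.comp (hej j) measurable_id
  have hei : ∀ j, Integrable (fun ω => if e ω j = true then (0 : ℝ) else 1) P := fun j =>
    integrable_of_mem_unitInterval ((hej j).comp he)
      (fun ω => by split_ifs <;> simp)
      (fun ω => by split_ifs <;> simp)
  have hint : ∀ j, ∫ ω, (if e ω j = true then (0 : ℝ) else 1) ∂P = 1 - q j := fun j => by
    have hm : MeasurableSet {ω | e ω j = true} :=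
      ((measurable_pi_apply j).comp he) (measurableSet_singleton true)
    rw [← hq, ← probReal_compl_eq_one_sub hm, ← integral_indicator_one hm.compl]
    exact integral_congr_ae (ae_of_all _ fun ω => by
      by_cases h : e ω j = true <;> simp [h])
  have hterm : ∀ j, ∫ ω, ε / (1 - q j) * ((if e ω j = true then (0 : ℝ) else 1) *
      (if d ω = j then G ω else 0)) ∂P = ε * ∫ ω, (if d ω = j then G ω else 0) ∂P := fun j => by
    have h1 : 1 - q j ≠ 0 := (sub_pos.2 (hq1 j)).ne'
    rw [integral_const_mul, (hind j).integral_fun_mul_eq_mul_integral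
      (hei j).aestronglyMeasurable (hGji j).aestronglyMeasurable, hint]
    field_simp
  have hti : ∀ j, Integrable (fun ω => ε / (1 - q j) * ((if e ω j = true then (0 : ℝ) else 1) *
      (if d ω = j then G ω else 0))) P := fun j =>
    ((hind j).integrable_mul (hei j) (hGji j)).const_mul _
  calc _ = ∫ ω, (ε / (1 - q true) * ((if e ω true = true then (0 : ℝ) else 1) *
          (if d ω = true then G ω else 0)) + ε / (1 - q false) *
          ((if e ω false = true then (0 : ℝ) else 1) * (if d ω = false then G ω else 0))) ∂P := by
        refine integral_congr_ae (ae_of_all _ fun ω => ?_)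
        rcases hdω : d ω with _ | _ <;> simp [hdω]
    _ = ε * ∫ ω, ((if d ω = true then G ω else 0) + (if d ω = false then G ω else 0)) ∂P := by
        rw [integral_add (hti true) (hti false), hterm, hterm,
          integral_add (hGji true) (hGji false)]
        ring
    _ = _ := by
        congr 1
        refine integral_congr_ae (ae_of_all _ fun ω => ?_)
        rcases hdω : d ω with _ | _ <;> simp [hdω]

lemma risk_mix {Ω : Type*} [MeasurableSpace Ω] {P : Bool → Measure Ω} {p : Bool → ℝ} {ε : ℝ}
    {φ f ψ : Ω → ℝ}
    (h : ∀ j, ∫ ω, φ ω ∂P j = ε * ∫ ω, f ω ∂P j + (1 - ε) * ∫ ω, ψ ω ∂P j) :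
    risk P p φ = ε * risk P p f + (1 - ε) * risk P p ψ := by
  rw [risk, risk, risk, h, h]
  ring

/-! ### Independence in the network and the one-node error bound -/

section Network

variable {Ω S : Type*} [MeasurableSpace S] {X : ℕ → Ω → S} {E : ℕ → Ω → Bool → Bool}

/-- The σ-algebra generated by the private signal of the node `l` and by the private signals and
the channels of all other nodes. -/
@[reducible]
def allButChannel (X : ℕ → Ω → S) (E : ℕ → Ω → Bool → Bool) (l : ℕ) : MeasurableSpace Ω :=
  MeasurableSpace.comap (X l) inferInstance ⊔
    ⨆ i ∈ ({l}ᶜ : Set ℕ), MeasurableSpace.comap (fun ω => (X i ω, E i ω)) inferInstance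

/-- The σ-algebra generated by the private signals and the channels of all nodes but `l`. -/
@[reducible]
def otherNodes (X : ℕ → Ω → S) (E : ℕ → Ω → Bool → Bool) (l : ℕ) : MeasurableSpace Ω :=
  ⨆ i ∈ ({l}ᶜ : Set ℕ), MeasurableSpace.comap (fun ω => (X i ω, E i ω)) inferInstance

lemma measurable_pair_otherNodes {i l : ℕ} (h : i ≠ l) :
    Measurable[otherNodes X E l] fun ω => (X i ω, E i ω) :=
  Measurable.of_comap_le (le_iSup₂_of_le i h le_rfl)

lemma measurable_signal_otherNodes {i l : ℕ} (h : i ≠ l) : Measurable[otherNodes X E l] (X i) :=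
  measurable_fst.comp (measurable_pair_otherNodes (X := X) (E := E) h)

lemma measurable_channel_otherNodes {i l : ℕ} (h : i ≠ l) : Measurable[otherNodes X E l] (E i) :=
  measurable_snd.comp (measurable_pair_otherNodes (X := X) (E := E) h)

lemma otherNodes_le_allButChannel (l : ℕ) : otherNodes X E l ≤ allButChannel X E l :=
  le_sup_right

lemma measurable_signal_allButChannel (i l : ℕ) : Measurable[allButChannel X E l] (X i) := by
  rcases eq_or_ne i l with rfl | h
  · exact Measurable.of_comap_le le_sup_left
  · exact (measurable_signal_otherNodes h).mono (otherNodes_le_allButChannel l) le_rfl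

lemma measurable_channel_allButChannel {i l : ℕ} (h : i ≠ l) :
    Measurable[allButChannel X E l] (E i) :=
  (measurable_channel_otherNodes h).mono (otherNodes_le_allButChannel l) le_rfl

variable [MeasurableSpace Ω] {P : Bool → Measure Ω} [∀ j, IsProbabilityMeasure (P j)]

lemma otherNodes_le (hX : ∀ k, Measurable (X k)) (hE : ∀ k, Measurable (E k)) (l : ℕ) :
    otherNodes X E l ≤ ‹MeasurableSpace Ω› :=
  iSup₂_le fun i _ => ((hX i).prodMk (hE i)).comap_le

lemma allButChannel_le (hX : ∀ k, Measurable (X k)) (hE : ∀ k, Measurable (E k)) (l : ℕ) :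
    allButChannel X E l ≤ ‹MeasurableSpace Ω› :=
  sup_le (hX l).comap_le (otherNodes_le hX hE l)

/-- Independence of the pairs does not separate `E l` from `X l`, on which the decision of node `l`
depends; `hXE` does. -/
lemma indep_channel_allButChannel {Q : Measure Ω} [IsProbabilityMeasure Q]
    (hX : ∀ k, Measurable (X k)) (hE : ∀ k, Measurable (E k))
    (hXE : ∀ k, IndepFun (X k) (E k) Q) (hindep : iIndepFun (fun k ω => (X k ω, E k ω)) Q)
    (l : ℕ) :
    Indep (MeasurableSpace.comap (E l) inferInstance) (allButChannel X E l) Q := by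
  refine indep_sup_of_indep_sup (hX l).comap_le (hE l).comap_le (otherNodes_le hX hE l) (hXE l) ?_
  have := indep_comap_iSup_ne (fun k => (hX k).prodMk (hE k)) hindep l
  rwa [show MeasurableSpace.comap (fun ω => (X l ω, E l ω)) inferInstance = _ from
    MeasurableSpace.comap_prodMk (X l) (E l)] at this

lemma indepFun_signal_of_measurable_otherNodes {V : Type*} [MeasurableSpace V] {Q : Measure Ω}
    (hX : ∀ k, Measurable (X k)) (hE : ∀ k, Measurable (E k))
    (hindep : iIndepFun (fun k ω => (X k ω, E k ω)) Q) {k : ℕ} {D : Ω → V}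
    (hD : Measurable[otherNodes X E k] D) : IndepFun (X k) D Q := by
  have := indep_comap_iSup_ne (fun k => (hX k).prodMk (hE k)) hindep k
  rw [show MeasurableSpace.comap (fun ω => (X k ω, E k ω)) inferInstance = _ from
    MeasurableSpace.comap_prodMk (X k) (E k)] at this
  exact indep_of_indep_of_le_left (indep_of_indep_of_le_right this hD.comap_le) le_sup_left

lemma measurable_decision_otherNodes (P : Bool → Measure Ω) (μ : Bool → Measure S) (m : ℕ → ℕ)
    (t : ℕ → ℝ) {i k : ℕ} (hik : i < k) :
    Measurable[otherNodes X E k] (decision P μ X E m t i) :=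
  measurable_decision P μ m t i (fun _ hj => measurable_signal_otherNodes (by omega))
    (fun _ hj => measurable_channel_otherNodes (by omega))

lemma measurable_decision_allButChannel (P : Bool → Measure Ω) (μ : Bool → Measure S) (m : ℕ → ℕ)
    (t : ℕ → ℝ) {i l : ℕ} (hil : i ≤ l) :
    Measurable[allButChannel X E l] (decision P μ X E m t i) :=
  measurable_decision P μ m t i (fun j _ => measurable_signal_allButChannel j l)
    (fun _ hj => measurable_channel_allButChannel (by omega))

/-- The risk of the rule which uses the last accepted decision, when acceptances have
probability `ε`. -/
lemma risk_lastAcceptedRule_le {p : Bool → ℝ} (hp1 : p true ≤ 1) (μ : Bool → Measure S)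
    (m : ℕ → ℕ) (t : ℕ → ℝ) {q : ℕ → Bool → ℝ} {ε : ℝ} (hε : 0 < ε) (hε1 : ε ≤ 1)
    (hq : ∀ k j, q k j ≤ 1 - ε)
    (hX : ∀ k, Measurable (X k)) (hE : ∀ k, Measurable (E k))
    (hElaw : ∀ h k j, (P h).real {ω | E k ω j = true} = q k j)
    (hXE : ∀ h k, IndepFun (X k) (E k) (P h))
    (hindep : ∀ h, iIndepFun (fun k ω => (X k ω, E k ω)) (P h))
    {f : ℕ → Bool → S → ℝ} (hf : ∀ i j, Measurable (f i j))
    (hf0 : ∀ i j s, 0 ≤ f i j s) (hf1 : ∀ i j s, f i j s ≤ 1) {B : ℝ} (hB : 0 ≤ B)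
    (k r n : ℕ)
    (hfB : ∀ l, r ≤ l → l < r + n →
      risk P p (fun ω => f l (decision P μ X E m t l ω) (X k ω)) ≤ B) :
    risk P p (fun ω => lastAcceptedRule (fun i j => ε / (1 - q i j)) f r n
      (fun i => channelOut (E i ω) (decision P μ X E m t i ω)) (X k ω)) ≤ B + (1 - ε) ^ n := by
  have ha0 : ∀ i j, 0 ≤ ε / (1 - q i j) := fun i j =>
    div_nonneg hε.le (by linarith [hq i j])
  have ha1 : ∀ i j, ε / (1 - q i j) ≤ 1 := fun i j =>
    div_le_one_of_le₀ (by linarith [hq i j]) (by linarith [hq i j])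
  induction n with
  | zero =>
    -- With nothing accepted the rule decides `0`, whose risk is `p true ≤ 1`.
    simp only [lastAcceptedRule, risk, integral_zero, pow_zero]
    linarith
  | succ n ih =>
    have ih := ih fun l h1 h2 => hfB l h1 (by omega)
    have hl := hfB (r + n) (by omega) (by omega)
    simp only [fun ω => lastAcceptedRule_succ (a := fun i j => ε / (1 - q i j)) (f := f) r n
      (fun i => channelOut (E i ω) (decision P μ X E m t i ω)) (X k ω) rfl]
    set d := decision P μ X E m t
    set ψ : Ω → ℝ := fun ω => lastAcceptedRule (fun i j => ε / (1 - q i j)) f r n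
      (fun i => channelOut (E i ω) (d i ω)) (X k ω)
    have hle := allButChannel_le hX hE (r + n)
    -- This is why messages are read from the latest back: neither decision `r + n` nor the earlier
    -- messages involve channel `r + n`, whereas later decisions may.
    have hdm : ∀ i ≤ r + n, Measurable[allButChannel X E (r + n)] (d i) := fun i hi =>
      measurable_decision_allButChannel P μ m t hi
    have hψm : Measurable[allButChannel X E (r + n)] ψ :=
      measurable_lastAcceptedRule_comp hf r n (measurable_signal_allButChannel k _)
        (fun i hi => measurable_channel_allButChannel hi.ne) (fun i hi => hdm i hi.le)
    have hgm : Measurable[allButChannel X E (r + n)]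
        fun ω => f (r + n) (d (r + n) ω) (X k ω) :=
      measurable_bit_rule (hf _) (hdm _ le_rfl) (measurable_signal_allButChannel k _)
    have hψI := fun ω => lastAcceptedRule_mem_Icc ha0 ha1 hf0 hf1 r n
      (fun i => channelOut (E i ω) (d i ω)) (X k ω)
    have hψi : ∀ h, Integrable ψ (P h) := fun h =>
      integrable_of_mem_unitInterval (hψm.mono hle le_rfl) (fun ω => (hψI ω).1)
        (fun ω => (hψI ω).2)
    have hgi : ∀ h, Integrable (fun ω => f (r + n) (d (r + n) ω) (X k ω)) (P h) := fun h =>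
      integrable_of_mem_unitInterval (hgm.mono hle le_rfl) (fun ω => hf0 _ _ _)
        (fun ω => hf1 _ _ _)
    have hmix : ∀ h, ∫ ω, ((if E (r + n) ω (d (r + n) ω) = true then 0
          else ε / (1 - q (r + n) (d (r + n) ω))) *
          (f (r + n) (d (r + n) ω) (X k ω) - ψ ω) + ψ ω) ∂P h =
        ε * ∫ ω, f (r + n) (d (r + n) ω) (X k ω) ∂P h + (1 - ε) * ∫ ω, ψ ω ∂P h := fun h => by
      have hacc : Measurable fun ω => if E (r + n) ω (d (r + n) ω) = true then (0 : ℝ)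
          else ε / (1 - q (r + n) (d (r + n) ω)) :=
        (Measurable.of_discrete (f := fun x : (Bool → Bool) × Bool =>
          if x.1 x.2 = true then (0 : ℝ) else ε / (1 - q (r + n) x.2))).comp
          ((hE _).prodMk ((hdm _ le_rfl).mono hle le_rfl))
      have hint : Integrable (fun ω => (if E (r + n) ω (d (r + n) ω) = true then (0 : ℝ)
          else ε / (1 - q (r + n) (d (r + n) ω))) *
          (f (r + n) (d (r + n) ω) (X k ω) - ψ ω)) (P h) :=
        ((hgi h).sub (hψi h)).bdd_mul (c := 1) hacc.aestronglyMeasurable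
          (ae_of_all _ fun ω => by
            split_ifs
            · simp
            · rw [Real.norm_eq_abs, abs_of_nonneg (ha0 _ _)]; exact ha1 _ _)
      rw [integral_add hint (hψi h),
        integral_accept_mul (G := fun ω => f (r + n) (d (r + n) ω) (X k ω) - ψ ω) hle (hE _)
          (indep_channel_allButChannel hX hE (hXE h) (hindep h) _)
          (hdm _ le_rfl) (hgm.sub hψm) ((hgi h).sub (hψi h)) (hElaw h _)
          (fun j => by linarith [hq (r + n) j]) ε,
        integral_sub (hgi h) (hψi h)]
      ring
    rw [risk_mix hmix, pow_succ]
    have h1 := mul_le_mul_of_nonneg_left hl hε.le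
    have h2 := mul_le_mul_of_nonneg_left ih (sub_nonneg.2 hε1)
    linarith

lemma errorProb_decision_le {p : Bool → ℝ} (hp : ∀ j, 0 < p j) (hp1 : p true ≤ 1)
    {μ : Bool → Measure S} [∀ j, IsProbabilityMeasure (μ j)] (hμ₁₀ : μ true ≪ μ false)
    {m : ℕ → ℕ} {q : ℕ → Bool → ℝ} {ε : ℝ} (hε : 0 < ε) (hε1 : ε ≤ 1)
    (hq : ∀ k j, q k j ≤ 1 - ε)
    (hX : ∀ k, Measurable (X k)) (hE : ∀ k, Measurable (E k))
    (hXlaw : ∀ h k, (P h).map (X k) = μ h)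
    (hElaw : ∀ h k j, (P h).real {ω | E k ω j = true} = q k j)
    (hXE : ∀ h k, IndepFun (X k) (E k) (P h))
    (hindep : ∀ h, iIndepFun (fun k ω => (X k ω, E k ω)) (P h))
    {f : ℕ → Bool → S → ℝ} (hf : ∀ i j, Measurable (f i j))
    (hf0 : ∀ i j s, 0 ≤ f i j s) (hf1 : ∀ i j s, f i j s ≤ 1) {B : ℝ} (hB : 0 ≤ B)
    {k r n : ℕ} (hk : r + n = k) (hn : n ≤ m k)
    (hfB : ∀ l, r ≤ l → l < k → risk P p
      (fun ω => f l (decision P μ X E m (fun _ => p false / p true) l ω) (X k ω)) ≤ B) :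
    errorProb P p (decision P μ X E m (fun _ => p false / p true) k) ≤ B + (1 - ε) ^ n := by
  let _ : MeasurableSpace Msg := ⊤
  set t : ℕ → ℝ := fun _ => p false / p true
  have ha0 : ∀ i j, 0 ≤ ε / (1 - q i j) := fun i j =>
    div_nonneg hε.le (by linarith [hq i j])
  have ha1 : ∀ i j, ε / (1 - q i j) ≤ 1 := fun i j =>
    div_le_one_of_le₀ (by linarith [hq i j]) (by linarith [hq i j])
  let D : Ω → Set.Ico (k - m k) k → Msg := fun ω i =>
    channelOut (E i ω) (decision P μ X E m t i ω)
  have hD : Measurable[otherNodes X E k] D := @measurable_pi_lambda _ _ _ (otherNodes X E k) _ _ fun i =>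
    measurable_channelOut_comp (measurable_channel_otherNodes i.2.2.ne)
      (measurable_decision_otherNodes P μ m t i.2.2) id
  -- The padding value `none` is never read: `n ≤ m k` puts `r, …, k - 1` inside the window.
  let ext : (Set.Ico (k - m k) k → Msg) → ℕ → Msg := fun v i =>
    if h : i ∈ Set.Ico (k - m k) k then v ⟨i, h⟩ else none
  have hrule : (fun ω => lastAcceptedRule (fun i j => ε / (1 - q i j)) f r n
      (fun i => channelOut (E i ω) (decision P μ X E m t i ω)) (X k ω)) =
      fun ω => (fun s v => lastAcceptedRule (fun i j => ε / (1 - q i j)) f r n (ext v) s)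
        (X k ω) (D ω) := by
    funext ω
    refine lastAcceptedRule_congr r n _ fun i h1 h2 => ?_
    have : i ∈ Set.Ico (k - m k) k := ⟨by omega, by omega⟩
    simp only [ext, dif_pos this, D]
  refine le_trans ?_ (risk_lastAcceptedRule_le hp1 μ m t hε hε1 hq hX hE hElaw hXE hindep hf hf0
    hf1 hB k r n (hk ▸ hfB))
  rw [hrule]
  exact errorProb_le_risk_of_likelihoodRatioTest hμ₁₀ hp (hX k)
    (hD.mono (otherNodes_le hX hE k) le_rfl) (fun h => hXlaw h k)
    (fun h => indepFun_signal_of_measurable_otherNodes hX hE (hindep h) hD)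
    (fun v => measurable_lastAcceptedRule hf r n _)
    (fun s v => (lastAcceptedRule_mem_Icc ha0 ha1 hf0 hf1 r n _ s).1)
    (fun s v => (lastAcceptedRule_mem_Icc ha0 ha1 hf0 hf1 r n _ s).2)
    (measurable_decision P μ m t k (fun i _ => hX i) (fun i _ => hE i))
    (fun ω => decision_eq_true_iff P μ X E m t k ω)

end Network

/-! ### Limit superior argument and conclusion -/

/-- Apply `H` to the infimum of the eventual upper bounds, supposed positive. That infimum need not
itself be an eventual bound, hence the slack `c'' > c`. -/
lemma tendsto_zero_of_eventually_le_improve {u : ℕ → ℝ} (h0 : ∀ k, 0 ≤ u k) (h1 : ∀ k, u k ≤ 1)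
    (H : ∀ c, 0 < c → ∃ c' < c, ∃ c'' > c, (∀ᶠ k in atTop, u k ≤ c'') →
      ∀ᶠ k in atTop, u k ≤ c') : Tendsto u atTop (𝓝 0) := by
  set T : Set ℝ := {c | ∀ᶠ k in atTop, u k ≤ c}
  have hbdd : BddBelow T := ⟨0, fun c hc => by
    obtain ⟨k, hk⟩ := Eventually.exists (show ∀ᶠ k in atTop, u k ≤ c from hc)
    exact (h0 k).trans hk⟩
  have hne : T.Nonempty := ⟨1, Eventually.of_forall h1⟩
  have hup : ∀ c, sInf T < c → ∀ᶠ k in atTop, u k ≤ c := fun c hc => by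
    obtain ⟨b, hb, hbc⟩ := exists_lt_of_csInf_lt hne hc
    filter_upwards [show ∀ᶠ k in atTop, u k ≤ b from hb] with k hk using hk.trans hbc.le
  have hle : sInf T ≤ 0 := by
    by_contra! hpos
    obtain ⟨c', hc', c'', hc'', himp⟩ := H _ hpos
    exact absurd (csInf_le hbdd (himp (hup c'' hc''))) (not_le.2 hc')
  rw [Metric.tendsto_nhds]
  intro δ hδ
  filter_upwards [hup (δ / 2) (by linarith)] with k hk
  rw [Real.dist_eq, sub_zero, abs_of_nonneg (h0 k)]
  linarith

lemma errorProb_nonneg {Ω : Type*} [MeasurableSpace Ω] (P : Bool → Measure Ω) {p : Bool → ℝ}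
    (hp : ∀ j, 0 < p j) (d : Ω → Bool) : 0 ≤ errorProb P p d :=
  add_nonneg (mul_nonneg (hp false).le measureReal_nonneg)
    (mul_nonneg (hp true).le measureReal_nonneg)

lemma errorProb_le_one {Ω : Type*} [MeasurableSpace Ω] (P : Bool → Measure Ω)
    [∀ j, IsProbabilityMeasure (P j)] {p : Bool → ℝ} (hp : ∀ j, 0 < p j)
    (hp_sum : p false + p true = 1) (d : Ω → Bool) : errorProb P p d ≤ 1 := by
  rw [← hp_sum, errorProb]
  exact add_le_add (mul_le_of_le_one_right (hp false).le measureReal_le_one)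
    (mul_le_of_le_one_right (hp true).le measureReal_le_one)

end ErasureLearning

theorem theorem2 {Ω S : Type*} [MeasurableSpace Ω] [MeasurableSpace S]
    -- prior probabilities of the two hypotheses
    (p : Bool → ℝ) (hp_pos : ∀ j, 0 < p j) (hp_sum : p false + p true = 1)
    -- laws of a private signal under the two hypotheses
    (μ : Bool → Measure S) [∀ j, IsProbabilityMeasure (μ j)]
    (hμ₀₁ : μ false ≪ μ true) (hμ₁₀ : μ true ≪ μ false)
    (hμ : ErasureLearning.UnboundedLR μ)
    -- memory sizes
    (m : ℕ → ℕ) (hm : Tendsto m atTop atTop)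
    -- `q k j` is the probability that the channel of node `k` erases the decision `j`
    (q : ℕ → Bool → ℝ) (ε : ℝ) (hε : 0 < ε) (hq : ∀ k j, q k j ≤ 1 - ε)
    -- the probability measures associated with the two hypotheses
    (P : Bool → Measure Ω) [∀ j, IsProbabilityMeasure (P j)]
    -- private signals and channels, all of them independent under each hypothesis
    (X : ℕ → Ω → S) (E : ℕ → Ω → Bool → Bool)
    (hX : ∀ k, Measurable (X k)) (hE : ∀ k, Measurable (E k))
    (hXlaw : ∀ h k, (P h).map (X k) = μ h)
    (hElaw : ∀ h k j, (P h).real {ω | E k ω j = true} = q k j)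
    (hXE : ∀ h k, IndepFun (X k) (E k) (P h))
    (hindep : ∀ h, iIndepFun (fun k ω => (X k ω, E k ω)) (P h)) :
    ∃ t : ℕ → ℝ, (∀ k, 0 < t k) ∧
      Tendsto
        (fun k => ErasureLearning.errorProb P p (ErasureLearning.decision P μ X E m t k))
        atTop (𝓝 0) := by

  classical
  have hp1 : p true ≤ 1 := by linarith [hp_pos false]
  have hε1 : ε ≤ 1 := by
    have : 0 ≤ q 0 true := hElaw true 0 true ▸ measureReal_nonneg
    linarith [hq 0 true]
  refine ⟨fun _ => p false / p true, fun _ => div_pos (hp_pos _) (hp_pos _),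
    ErasureLearning.tendsto_zero_of_eventually_le_improve
      (fun k => ErasureLearning.errorProb_nonneg P hp_pos _)
      (fun k => ErasureLearning.errorProb_le_one P hp_pos hp_sum _) fun c hc => ?_⟩
  obtain ⟨γ, hγ, himp⟩ :=
    ErasureLearning.exists_rule_risk_le (P := P) hμ₀₁ hμ₁₀ hμ hp_pos hp_sum hc
  -- Errors at most `c + γ / 2` improve to at most `max (c / 2) (c - γ / 2) < c`. Then `M` makes the
  -- no-acceptance probability less than half of the gap `c - B`.
  obtain ⟨B, hBdef⟩ : ∃ B, B = max (c / 2) (c - γ / 2) := ⟨_, rfl⟩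
  have hB : 0 ≤ B := hBdef ▸ le_max_of_le_left (by linarith)
  have hBc : B < c := hBdef ▸ max_lt (by linarith) (by linarith)
  obtain ⟨M, hM⟩ := exists_pow_lt_of_lt_one (show 0 < (c - B) / 2 by linarith)
    (show 1 - ε < 1 by linarith)
  refine ⟨(B + c) / 2, by linarith, c + γ / 2, by linarith, fun hev => ?_⟩
  obtain ⟨N, hN⟩ := eventually_atTop.1 hev
  -- The `M` predecessors of `k` are then all in its memory and have index at least `N`.
  filter_upwards [hm.eventually_ge_atTop M, eventually_ge_atTop (N + M)] with k hmk hk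
  -- The rule depends on `l`, since the dominant error type may vary; outside the window any rule
  -- will do.
  have hrule : ∀ l, ∃ f : Bool → S → ℝ, (∀ j, Measurable (f j)) ∧ (∀ j s, 0 ≤ f j s) ∧
      (∀ j s, f j s ≤ 1) ∧ (k - M ≤ l → l < k → ErasureLearning.risk P p (fun ω =>
        f (ErasureLearning.decision P μ X E m (fun _ => p false / p true) l ω) (X k ω)) ≤ B) := by
    intro l
    by_cases hl : k - M ≤ l ∧ l < k
    · have hd := ErasureLearning.measurable_decision_otherNodes (X := X) (E := E) P μ m
        (fun _ => p false / p true) hl.2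
      obtain ⟨f, hf, hf0, hf1, hr⟩ := himp (X k) _ (hX k)
        (hd.mono (ErasureLearning.otherNodes_le hX hE k) le_rfl) (fun h => hXlaw h k)
        (fun h => ErasureLearning.indepFun_signal_of_measurable_otherNodes hX hE (hindep h) hd)
      refine ⟨f, hf, hf0, hf1, fun _ _ => hr.trans (hBdef ▸ max_le_max le_rfl ?_)⟩
      linarith [hN l (by omega)]
    · exact ⟨fun _ _ => 0, fun _ => measurable_const, fun _ _ => le_rfl, fun _ _ => zero_le_one,
        fun h1 h2 => absurd ⟨h1, h2⟩ hl⟩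
  choose f hf hf0 hf1 hfB using hrule
  have := ErasureLearning.errorProb_decision_le hp_pos hp1 hμ₁₀ hε hε1 hq hX hE hXlaw hElaw hXE
    hindep hf hf0 hf1 hB (show k - M + M = k by omega) hmk hfB
  linarith
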